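/- All graphs are finite and simple. A coloring $c:V(G)\to\{1,\dots,d\}$ of the vertices of a graph $G$ is distinguishing if the identity is the only automorphism $\sigma$ of $G$ with $c\circ\sigma=c$, and the distinguishing number $D(G)$ is the least $d$ for which $G$ has a distinguishing coloring with $d$ colors. In the distinguishing game on $G$ with $d\ge 1$ colors, two players, Gentle and Rascal, alternately choose an uncolored vertex of $G$ and color it with one of the $d$ colors until all vertices are colored; Gentle wins if the final coloring is distinguishing, and Rascal wins otherwise. The $R$-game distinguishing number $D_{\mathcal R}(G)$ is the least $d\ge 1$ such that Gentle has a winning strategy with $d$ colors when Rascal plays first ($D_{\mathcal R}(G)=\infty$ if there is no such $d$). Let $\square$ denote the cartesian product of graphs, and call two graphs relatively prime if there is no graph with at least two vertices that is, up to isomorphism, a factor of both with respect to $\square$. Let $C_n$ be the cycle of order $n\ge 3$. **Proposition.** Let $n\in\{4,6\}$ and let $F$ be a connected graph with at least three vertices that is relatively prime to $C_n$. If $D(F)\le 3$, then $D_{\mathcal R}(C_n\square F)=2$. In particular, for every integer $m\ge 3$: if $m\ne 6$, then $D_{\mathcal R}(C_6\square C_m)=2$; and if $m\ne 4$, then $D_{\mathcal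 R}(C_4\square C_m)=2$. -/

import Mathlib

universe u

namespace DistinguishingGame

/-- A vertex-colouring `c` of `G` with `d` colours is distinguishing if the identity is the only
automorphism of `G` that preserves `c`. -/
def IsDistinguishing {V : Type*} (G : SimpleGraph V) {d : ℕ} (c : V → Fin d) : Prop :=
  ∀ σ : G ≃g G, (∀ v, c (σ v) = c v) → ∀ v, σ v = v

/-- The distinguishing number `D(G)`: the least `d` such that `G` has a distinguishing colouring
with `d` colours (`⊤` if there is none, which does not happen for finite `G`). -/
noncomputable def distNumber {V : Type*} (G : SimpleGraph V) : ℕ∞ :=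
  ⨅ (d : ℕ) (_ : ∃ c : V → Fin d, IsDistinguishing G c), (d : ℕ∞)

/-- The two players of the distinguishing game. -/
inductive Player
  | gentle
  | rascal

open Classical in
/-- `GentleWins G d P p`: in the distinguishing game on `G` with `d` colours, Gentle has a winning
strategy from the position `p` with player `P` to move. A position records for every vertex whether
it is uncoloured (`none`) or coloured with `k` (`some k`). A move consists in colouring one
uncoloured vertex with one of the `d` colours.
* Once all vertices are coloured the game is over, and Gentle wins iff the colouring is
  distinguishing.
* With Gentle to move, he wins iff some move leads to a position, with Rascal to move, that he wins.
* With Rascal to move (and some vertex uncoloured), Gentle wins iff all the moves of Rascal lead to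
  positions, with Gentle to move, that Gentle wins. -/
inductive GentleWins {V : Type*} (G : SimpleGraph V) (d : ℕ) :
    Player → (V → Option (Fin d)) → Prop
  | finished (P : Player) (c : V → Fin d) (hc : IsDistinguishing G c) :
      GentleWins G d P (fun v => some (c v))
  | gentleMove (p : V → Option (Fin d)) (v : V) (k : Fin d) (hv : p v = none)
      (h : GentleWins G d Player.rascal (Function.update p v (some k))) :
      GentleWins G d Player.gentle p
  | rascalMove (p : V → Option (Fin d)) (hp : ∃ v, p v = none)
      (h : ∀ (v : V) (k : Fin d), p v = none →
        GentleWins G d Player.gentle (Function.update p v (some k))) :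
      GentleWins G d Player.rascal p

/-- The `R`-game distinguishing number `D_R(G)`: the least number `d ≥ 1` of colours with which
Gentle has a winning strategy on `G` when Rascal starts, and `⊤` if there is no such `d`. -/
noncomputable def gameDistNumberR {V : Type*} (G : SimpleGraph V) : ℕ∞ :=
  ⨅ (d : ℕ) (_ : 1 ≤ d ∧ GentleWins G d Player.rascal (fun _ => none)), (d : ℕ∞)

/-- `K` is a factor of `G` with respect to the cartesian product of graphs. -/
def IsCartesianFactor {W : Type*} {V : Type u} (K : SimpleGraph W) (G : SimpleGraph V) : Prop :=
  ∃ (X : Type u) (L : SimpleGraph X), Nonempty (G ≃g K □ L)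

/-- Two finite graphs are relatively prime (with respect to the cartesian product) if they have no
common factor with at least two vertices. As the graphs are finite, it suffices to consider
factors on the vertex sets `Fin k`. -/
def RelativelyPrime {V W : Type*} (G : SimpleGraph V) (H : SimpleGraph W) : Prop :=
  ∀ (k : ℕ) (K : SimpleGraph (Fin k)), 2 ≤ k → IsCartesianFactor K G → ¬ IsCartesianFactor K H

end DistinguishingGame

/-!
Gentle pairs the vertices of every copy of `Cₙ` by antipodality `τ` and always answers in the vertex
antipodal to the one Rascal has just coloured, with the same or with the other colour as he decides
in advance for that pair (`GentleWins.of_pairing`). With `n / 2` pairs per copy there are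
`n / 2 + 1 ≥ 3` possible numbers of unequal pairs. As `D(F) ≤ 3` and `F` has at least three vertices,
`F` has a distinguishing colouring that uses exactly three colours
(`exists_isDistinguishing_surjective`), and Gentle lets the number of unequal pairs in the copy over
`v` encode the colour of `v`.

It has to be known that every automorphism of `Cₙ □ F` is a product `a × b` of automorphisms of the
factors. Then, as `a` commutes with `τ`, a colour-preserving automorphism preserves the numbers of
unequal pairs, so `b` is trivial. Hence `a` preserves the colouring of each copy separately. For one
copy exactly one pair is unequal, which makes `a` fix its two vertices; the pattern of a second copy,
with two unequal pairs, excludes the remaining reflection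
(`gameDistNumberR_boxProd_eq_two` and its two applications).

For the automorphisms of `Cₙ □ F`, the point is that distances in a cartesian product add up
coordinatewise, so that the preimage of a fibre under an automorphism is a box
(`Iso.fst_eq_of_fst_eq`). If an automorphism maps an edge of a copy of `Cₙ` into a fibre `{a} × F`,
the preimage of this fibre is a box that exhibits `F` as a product of a subgraph of `Cₙ` with at
least two vertices and a subgraph of `F` (`Iso.fiberEquivBox`). The first factor is all of `C₆` if
`n = 6`, as `C₆` has no 4-cycles, and it is `K₂` or `C₄` if `n = 4`. In each case it is a common
factor of `F` and `Cₙ`.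

For the particular case `F = Cₘ`, cycles of length other than 4 are prime, and `C₄` has no factors
other than `K₁`, `K₂` and itself (`card_eq_of_isCartesianFactor_cycleGraph`).
-/

/-! ### Cartesian products and their automorphisms -/

namespace SimpleGraph

variable {α β α' β' : Type*} {G : SimpleGraph α} {H : SimpleGraph β}
  {G' : SimpleGraph α'} {H' : SimpleGraph β'}

/-- The cartesian product of two graph isomorphisms. -/
def Iso.boxProdCongr (e : G ≃g G') (f : H ≃g H') : (G □ H) ≃g (G' □ H') where
  toEquiv := e.toEquiv.prodCongr f.toEquiv
  map_rel_iff' := by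
    intro x y
    simp [boxProd_adj, e.map_adj_iff, f.map_adj_iff]

theorem Hom.dist_le (f : G →g G') (hG : G.Connected) (x y : α) :
    G'.dist (f x) (f y) ≤ G.dist x y := by
  obtain ⟨w, hw⟩ := hG.exists_walk_length_eq_dist x y
  rw [← hw, ← Walk.length_map f w]
  exact SimpleGraph.dist_le _

theorem Iso.dist_eq (f : G ≃g G') (hG : G.Connected) (x y : α) :
    G'.dist (f x) (f y) = G.dist x y := by
  refine le_antisymm (Hom.dist_le f.toHom hG x y) ?_
  have hG' : G'.Connected := f.connected_iff.1 hG
  have h := Hom.dist_le f.symm.toHom hG' (f x) (f y)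
  simpa using h

theorem Connected.dist_boxProd (hG : G.Connected) (hH : H.Connected) (x y : α × β) :
    (G □ H).dist x y = G.dist x.1 y.1 + H.dist x.2 y.2 := by
  have h := edist_boxProd (G := G) (H := H) x y
  rw [← ((hG.boxProd hH).preconnected x y).coe_dist_eq_edist,
    ← (hG.preconnected _ _).coe_dist_eq_edist, ← (hH.preconnected _ _).coe_dist_eq_edist] at h
  exact_mod_cast h

/-- In a product of connected graphs, a vertex that agrees with `x` in one coordinate and with `y`
in the other lies on a geodesic from `x` to `y`. As fibres are convex, their preimages under
isomorphisms are therefore boxes. -/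
theorem Iso.fst_eq_of_fst_eq (φ : (G □ H) ≃g (G' □ H')) (hG : G.Connected) (hH : H.Connected)
    {p p' : α} {q q' : β} (h : (φ (p, q)).1 = (φ (p', q')).1) :
    (φ (p, q')).1 = (φ (p, q)).1 := by
  have hφ := φ.connected_iff.1 (hG.boxProd hH)
  have hG' : G'.Connected := hφ.ofBoxProdLeft
  have hH' : H'.Connected := hφ.ofBoxProdRight
  have d (x y : α × β) : G'.dist (φ x).1 (φ y).1 + H'.dist (φ x).2 (φ y).2 =
      G.dist x.1 y.1 + H.dist x.2 y.2 := by
    rw [← hG'.dist_boxProd hH', φ.dist_eq (hG.boxProd hH), hG.dist_boxProd hH]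
  have h1 := d (p, q) (p', q')
  have h2 := d (p, q) (p, q')
  have h3 := d (p, q') (p', q')
  have ht := hH'.dist_triangle (u := (φ (p, q)).2) (v := (φ (p, q')).2) (w := (φ (p', q')).2)
  rw [← h, dist_self] at h1
  rw [← h] at h3
  simp only [dist_self] at h1 h2 h3
  exact (hG'.dist_eq_zero_iff.1 (by omega)).symm

/-- The preimage of a fibre `{a} × β` under an automorphism of `G □ H` is a box, so that `H` is
isomorphic to the product of an induced subgraph of `G` and one of `H`, the projections of the
preimage. -/
def Iso.fiberEquivBox (φ : (G □ H) ≃g (G □ H)) (hG : G.Connected) (hH : H.Connected) (a : α) :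
    H ≃g (G.induce {p | ∃ q, (φ (p, q)).1 = a}) □ (H.induce {q | ∃ p, (φ (p, q)).1 = a}) :=
  have key (p : α) (q : β) (hp : ∃ q, (φ (p, q)).1 = a) (hq : ∃ p, (φ (p, q)).1 = a) :
      (φ (p, q)).1 = a := by
    obtain ⟨q', hq'⟩ := hp
    obtain ⟨p', hp'⟩ := hq
    exact (φ.fst_eq_of_fst_eq hG hH (hq'.trans hp'.symm)).trans hq'
  Iso.symm
  { toFun := fun x => (φ (x.1.1, x.2.1)).2
    invFun := fun b => ⟨⟨(φ.symm (a, b)).1, (φ.symm (a, b)).2, by simp⟩,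
      ⟨(φ.symm (a, b)).2, (φ.symm (a, b)).1, by simp⟩⟩
    left_inv := by
      rintro ⟨⟨p, hp⟩, ⟨q, hq⟩⟩
      have h : (a, (φ (p, q)).2) = φ (p, q) := Prod.ext (key p q hp hq).symm rfl
      ext <;> simp [h]
    right_inv := by
      intro b
      simp
    map_rel_iff' := by
      rintro ⟨⟨p, hp⟩, ⟨q, hq⟩⟩ ⟨⟨p', hp'⟩, ⟨q', hq'⟩⟩
      have h : (G □ H).Adj (φ (p, q)) (φ (p', q')) ↔ (G □ H).Adj (p, q) (p', q') :=
        φ.map_adj_iff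
      rw [boxProd_adj, boxProd_adj, key p q hp hq, key p' q' hp' hq'] at h
      simpa [boxProd_adj, Subtype.ext_iff] using h }

/-- Two distinct vertices of a fibre have all their common neighbours in that fibre. -/
theorem fst_eq_of_adj_of_adj {x y z : α × β} (hxy : x.1 = y.1) (hne : x ≠ y)
    (hx : (G □ H).Adj x z) (hy : (G □ H).Adj y z) : z.1 = x.1 := by
  rcases hx with ⟨-, hx⟩ | ⟨-, hx⟩
  · rcases hy with ⟨-, hy⟩ | ⟨-, hy⟩
    · exact absurd (Prod.ext hxy (hx.trans hy.symm)) hne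
    · exact (hxy.trans hy).symm
  · exact hx.symm

/-- The analogue of `fst_eq_of_adj_of_adj` for the fibres over the second coordinate. -/
theorem snd_eq_of_adj_of_adj {x y z : α × β} (hxy : x.2 = y.2) (hne : x ≠ y)
    (hx : (G □ H).Adj x z) (hy : (G □ H).Adj y z) : z.2 = x.2 := by
  rcases hx with ⟨-, hx⟩ | ⟨-, hx⟩
  · exact hx.symm
  · rcases hy with ⟨-, hy⟩ | ⟨-, hy⟩
    · exact (hxy.trans hy).symm
    · exact absurd (Prod.ext (hx.trans hy.symm) hxy) hne

theorem Connected.eq_of_forall_adj {γ : Type*} (hG : G.Connected) {f : α → γ}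
    (hf : ∀ x y, G.Adj x y → f x = f y) (x y : α) : f x = f y := by
  obtain ⟨w⟩ := hG.preconnected x y
  induction w with
  | nil => rfl
  | cons h _ ih => exact (hf _ _ h).trans ih

/-- If an automorphism of `G □ H` and its inverse both map every copy of an edge of `G` to a copy of
an edge of `G`, then each coordinate of the image depends on the same coordinate only. -/
theorem Iso.exists_map_prod (φ : (G □ H) ≃g (G □ H)) (hG : G.Connected) (hH : H.Connected)
    (h : ∀ p p' q, G.Adj p p' → (φ (p, q)).2 = (φ (p', q)).2)
    (h' : ∀ p p' q, G.Adj p p' → (φ.symm (p, q)).2 = (φ.symm (p', q)).2) :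
    ∃ (a : α → α) (b : β → β), ∀ p q, φ (p, q) = (a p, b q) := by
  obtain ⟨p₀⟩ := hG.nonempty
  obtain ⟨q₀⟩ := hH.nonempty
  refine ⟨fun p => (φ (p, q₀)).1, fun q => (φ (p₀, q)).2, fun p q => Prod.ext ?_ ?_⟩
  · refine hH.eq_of_forall_adj (f := fun q => (φ (p, q)).1) (fun q q' hq => ?_) _ _
    have hadj : (G □ H).Adj (φ (p, q)) (φ (p, q')) := φ.map_adj_iff.2 (boxProd_adj_right.2 hq)
    rcases hadj with ⟨hadj, heq⟩ | ⟨-, heq⟩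
    · have hs := h' _ _ (φ (p, q)).2 hadj
      have hq' : ((φ (p, q')).1, (φ (p, q)).2) = φ (p, q') := Prod.ext rfl heq
      rw [hq', Prod.mk.eta, φ.symm_apply_apply, φ.symm_apply_apply] at hs
      exact absurd hs hq.ne
    · exact heq
  · exact hG.eq_of_forall_adj (f := fun p => (φ (p, q)).2) (fun _ _ hp => h _ _ _ hp) _ _

/-- If every automorphism of `G □ H` maps every copy of an edge of `G` to a copy of an edge of `G`,
then all automorphisms are products of automorphisms of the factors. -/
theorem Iso.exists_eq_boxProdCongr (hG : G.Connected) (hH : H.Connected)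
    (h : ∀ (φ : (G □ H) ≃g (G □ H)) p p' q, G.Adj p p' → (φ (p, q)).2 = (φ (p', q)).2)
    (φ : (G □ H) ≃g (G □ H)) :
    ∃ (a : G ≃g G) (b : H ≃g H), φ = a.boxProdCongr b := by
  obtain ⟨a, b, hab⟩ := φ.exists_map_prod hG hH (h φ) (h φ.symm)
  obtain ⟨a', b', hab'⟩ := φ.symm.exists_map_prod hG hH (h φ.symm) (h φ)
  have e₁ (p q) : a' (a p) = p ∧ b' (b q) = q := by
    have := φ.symm_apply_apply (p, q)
    rwa [hab, hab', Prod.mk.injEq] at this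
  have e₂ (p q) : a (a' p) = p ∧ b (b' q) = q := by
    have := φ.apply_symm_apply (p, q)
    rwa [hab', hab, Prod.mk.injEq] at this
  obtain ⟨p₀⟩ := hG.nonempty
  obtain ⟨q₀⟩ := hH.nonempty
  refine ⟨⟨⟨a, a', fun p => (e₁ p q₀).1, fun p => (e₂ p q₀).1⟩, fun {p p'} => ?_⟩,
    ⟨⟨b, b', fun q => (e₁ p₀ q).2, fun q => (e₂ p₀ q).2⟩, fun {q q'} => ?_⟩, ?_⟩
  · have := φ.map_adj_iff (v := (p, q₀)) (w := (p', q₀))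
    rwa [hab, hab, boxProd_adj_left, boxProd_adj_left] at this
  · have := φ.map_adj_iff (v := (p₀, q)) (w := (p₀, q'))
    rwa [hab, hab, boxProd_adj_right, boxProd_adj_right] at this
  · ext1 ⟨p, q⟩
    exact hab p q

end SimpleGraph

namespace DistinguishingGame

open SimpleGraph

/-! ### Automorphisms of products with a 4-cycle or a 6-cycle -/

theorem IsCartesianFactor.of_iso {W W' : Type*} {V : Type u} {K : SimpleGraph W}
    {K' : SimpleGraph W'} {G : SimpleGraph V} (h : IsCartesianFactor K G) (e : K ≃g K') :
    IsCartesianFactor K' G := by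
  obtain ⟨X, L, ⟨f⟩⟩ := h
  exact ⟨X, L, ⟨f.trans (e.boxProdCongr Iso.refl)⟩⟩

theorem isCartesianFactor_self {V : Type*} (G : SimpleGraph V) : IsCartesianFactor G G :=
  ⟨PUnit, ⊥, ⟨⟨(Equiv.prodPUnit V).symm, by simp [boxProd_adj]⟩⟩⟩

/-- The vertices of `C₄ = K₂ □ K₂` in cyclic order are `00, 01, 11, 10`. -/
theorem isCartesianFactor_cycleGraph_four :
    IsCartesianFactor (⊤ : SimpleGraph (Fin 2)) (cycleGraph 4) :=
  ⟨Fin 2, ⊤, ⟨⟨⟨![(0, 0), (0, 1), (1, 1), (1, 0)], fun x => ![![0, 1], ![3, 2]] x.1 x.2,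
    by decide, by decide⟩, by
      intro a b
      simp only [boxProd_adj, top_adj]
      revert a b
      decide⟩⟩⟩

section Automorphisms

variable {V : Type u} {F : SimpleGraph V}

/-- If an edge of a copy of `C₄` is mapped into a fibre `{a} × V`, then the preimage of that fibre
meets the copies of `C₄` in an edge or in all of `C₄`; in both cases `C₄` and `F` have a common
factor. -/
theorem snd_eq_of_relativelyPrime_cycleGraph_four (hF : F.Connected)
    (h : RelativelyPrime F (cycleGraph 4)) (φ : (cycleGraph 4 □ F) ≃g (cycleGraph 4 □ F))
    (p p' : Fin 4) (q : V) (hp : (cycleGraph 4).Adj p p') : (φ (p, q)).2 = (φ (p', q)).2 := by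
  have hadj : (cycleGraph 4 □ F).Adj (φ (p, q)) (φ (p', q)) :=
    φ.map_adj_iff.2 (boxProd_adj_left.2 hp)
  rcases hadj with ⟨-, heq⟩ | ⟨-, heq⟩
  · exact heq
  exfalso
  have hC : (cycleGraph 4).Connected := cycleGraph_connected
  set a := (φ (p, q)).1 with ha
  let e := φ.fiberEquivBox hC hF a
  set P : Set (Fin 4) := {p | ∃ q, (φ (p, q)).1 = a}
  have mem {x : Fin 4} (hx : x ∈ P) : (φ (x, q)).1 = a := by
    obtain ⟨q', hq'⟩ := hx
    rw [← hq']
    exact φ.fst_eq_of_fst_eq hC hF (p' := p) (q' := q) (hq'.trans ha)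
  have hclosed (x y z : Fin 4) (hx : x ∈ P) (hy : y ∈ P) (hxy : x ≠ y)
      (hxz : (cycleGraph 4).Adj x z) (hyz : (cycleGraph 4).Adj y z) : z ∈ P := by
    refine ⟨q, (fst_eq_of_adj_of_adj (G := cycleGraph 4) (H := F) (x := φ (x, q))
      (y := φ (y, q)) ((mem hx).trans (mem hy).symm) ?_ ?_ ?_).trans (mem hx)⟩
    · simpa using hxy
    · exact φ.map_adj_iff.2 (boxProd_adj_left.2 hxz)
    · exact φ.map_adj_iff.2 (boxProd_adj_left.2 hyz)
  have hpP : p ∈ P := ⟨q, rfl⟩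
  have hpP' : p' ∈ P := ⟨q, heq.symm⟩
  -- Three vertices of `C₄`, two of which are adjacent, have the fourth one as a common neighbour of
  -- two of them.
  have fourth : ∀ x y z : Fin 4, (cycleGraph 4).Adj x y → z ≠ x → z ≠ y → ∀ w,
      w = x ∨ w = y ∨ w = z ∨ (cycleGraph 4).Adj x w ∧ (cycleGraph 4).Adj z w ∨
        (cycleGraph 4).Adj y w ∧ (cycleGraph 4).Adj z w := by
    decide
  by_cases hthird : ∃ z ∈ P, z ≠ p ∧ z ≠ p'
  · obtain ⟨z, hz, hzp, hzp'⟩ := hthird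
    have hU : P = Set.univ := by
      refine Set.eq_univ_of_forall fun w => ?_
      rcases fourth p p' z hp hzp hzp' w with rfl | rfl | rfl | ⟨h1, h2⟩ | ⟨h1, h2⟩
      · exact hpP
      · exact hpP'
      · exact hz
      · exact hclosed p z w hpP hz hzp.symm h1 h2
      · exact hclosed p' z w hpP' hz hzp'.symm h1 h2
    refine h 4 (cycleGraph 4) (by norm_num) ?_ (isCartesianFactor_self _)
    refine IsCartesianFactor.of_iso ⟨_, _, ⟨e⟩⟩ ?_
    rw [hU]
    exact induceUnivIso _
  · have hU : P = {p, p'} := by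
      refine Set.Subset.antisymm (fun z hz => ?_) (Set.pair_subset hpP hpP')
      by_contra hzne
      exact hthird ⟨z, hz, by simpa using hzne⟩
    refine h 2 ⊤ le_rfl ?_ isCartesianFactor_cycleGraph_four
    refine IsCartesianFactor.of_iso ⟨_, _, ⟨e⟩⟩ ?_
    rw [hU]
    have htop : (cycleGraph 4).induce ({p, p'} : Set (Fin 4)) = ⊤ := by
      ext ⟨x, hx⟩ ⟨y, hy⟩
      rcases hx with rfl | rfl <;> rcases hy with rfl | rfl <;>
        simp [hp, hp.symm, Subtype.ext_iff, hp.ne, hp.ne']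
    rw [htop]
    refine Iso.completeGraph (Fintype.equivFinOfCardEq ?_)
    rw [← Nat.card_eq_fintype_card, Nat.card_coe_set_eq, Set.ncard_pair hp.ne]

/-- As `C₆` has no 4-cycles, consecutive edges of a copy of `C₆` have images in the same
direction. If an edge of a copy of `C₆` is mapped into a fibre `{a} × V`, then so is the whole copy,
and `C₆` is a factor of `F`. -/
theorem snd_eq_of_relativelyPrime_cycleGraph_six (hF : F.Connected)
    (h : RelativelyPrime F (cycleGraph 6)) (φ : (cycleGraph 6 □ F) ≃g (cycleGraph 6 □ F))
    (p p' : Fin 6) (q : V) (hp : (cycleGraph 6).Adj p p') : (φ (p, q)).2 = (φ (p', q)).2 := by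
  have hC : (cycleGraph 6).Connected := cycleGraph_connected
  have hadj {x y : Fin 6} (hxy : (cycleGraph 6).Adj x y) :
      (cycleGraph 6 □ F).Adj (φ (x, q)) (φ (y, q)) :=
    φ.map_adj_iff.2 (boxProd_adj_left.2 hxy)
  have noSquare : ∀ x y z w : Fin 6, (cycleGraph 6).Adj x y → (cycleGraph 6).Adj y z →
      (cycleGraph 6).Adj x w → (cycleGraph 6).Adj z w → x ≠ z → w = y := by
    decide
  rcases hadj hp with ⟨-, heq⟩ | ⟨-, heq⟩
  · exact heq
  exfalso
  have step (x y z : Fin 6) (hxy : (cycleGraph 6).Adj x y) (hyz : (cycleGraph 6).Adj y z)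
      (hx : (φ (x, q)).1 = (φ (y, q)).1) : (φ (y, q)).1 = (φ (z, q)).1 := by
    by_cases hxz : x = z
    · rw [← hxz, hx]
    rcases hadj hyz with ⟨hK, h2⟩ | ⟨-, h1⟩
    · exfalso
      have hFadj : F.Adj (φ (x, q)).2 (φ (y, q)).2 := by
        rcases hadj hxy with ⟨h3, -⟩ | ⟨h3, -⟩
        · exact absurd hx h3.ne
        · exact h3
      -- The fourth vertex of the square spanned by the two images.
      set w := φ.symm ((φ (z, q)).1, (φ (x, q)).2) with hw
      have hφw : φ w = ((φ (z, q)).1, (φ (x, q)).2) := by simp [hw]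
      have hxw : (cycleGraph 6 □ F).Adj (x, q) w := by
        rw [← φ.map_adj_iff, hφw]
        exact Or.inl ⟨by rw [hx]; exact hK, rfl⟩
      have hzw : (cycleGraph 6 □ F).Adj (z, q) w := by
        rw [← φ.map_adj_iff, hφw]
        exact Or.inr ⟨by rw [← h2]; exact hFadj.symm, rfl⟩
      have hwq : w.2 = q :=
        snd_eq_of_adj_of_adj (x := (x, q)) (y := (z, q)) rfl (by simpa using hxz) hxw hzw
      have hw' : w = (w.1, q) := Prod.ext rfl hwq
      rw [hw', boxProd_adj_left] at hxw hzw
      have hwy : w = (y, q) := by rw [hw', noSquare x y z w.1 hxy hyz hxw hzw hxz]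
      rw [hwy] at hφw
      exact hFadj.ne (congrArg Prod.snd hφw).symm
    · exact h1
  set a := (φ (p, q)).1 with ha
  have around {x y v : Fin 6} (w : (cycleGraph 6).Walk y v) (hxy : (cycleGraph 6).Adj x y)
      (hx : (φ (x, q)).1 = a) (hy : (φ (y, q)).1 = a) : (φ (v, q)).1 = a := by
    induction w generalizing x with
    | nil => exact hy
    | cons hyz _ ih => exact ih hyz hy ((step _ _ _ hxy hyz (hx.trans hy.symm)).symm.trans hy)
  have hall (x : Fin 6) : (φ (x, q)).1 = a := by
    obtain ⟨w⟩ := hC.preconnected p' x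
    exact around w hp rfl heq.symm
  have hU : {p | ∃ q, (φ (p, q)).1 = a} = Set.univ :=
    Set.eq_univ_of_forall fun x => ⟨q, hall x⟩
  refine h 6 (cycleGraph 6) (by norm_num) ?_ (isCartesianFactor_self _)
  refine IsCartesianFactor.of_iso ⟨_, _, ⟨φ.fiberEquivBox hC hF a⟩⟩ ?_
  rw [hU]
  exact induceUnivIso _

end Automorphisms

/-! ### The pairing strategy -/

/-- Gentle answers each move of Rascal in the vertex paired with it by `τ`, with the same colour or
the other colour as `s` prescribes. -/
theorem GentleWins.of_pairing {U : Type*} [Finite U] (G : SimpleGraph U) (τ : U → U)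
    (s : U → Prop) (hτ : ∀ u, τ (τ u) = u) (hne : ∀ u, τ u ≠ u) (hs : ∀ u, s (τ u) ↔ s u)
    (hwin : ∀ c : U → Fin 2, (∀ u, c u = c (τ u) ↔ s u) → IsDistinguishing G c) :
    GentleWins G 2 Player.rascal (fun _ => none) := by
  classical
  -- Before each move of Rascal, both vertices of a pair are uncoloured, or they are coloured as
  -- prescribed.
  suffices H : ∀ (N : ℕ) (p : U → Option (Fin 2)), Nat.card {u // p u = none} = N →
      (∀ u, p u = none ∧ p (τ u) = none ∨
        p u ≠ none ∧ p (τ u) ≠ none ∧ (p u = p (τ u) ↔ s u)) →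
      GentleWins G 2 Player.rascal p from
    H _ _ rfl fun u => Or.inl ⟨rfl, rfl⟩
  intro N
  induction N using Nat.strong_induction_on with
  | _ N ih =>
  intro p hN hp
  by_cases hex : ∃ v, p v = none
  · refine GentleWins.rascalMove p hex fun v k hv => ?_
    have hτv : p (τ v) = none := by
      rcases hp v with h | h
      · exact h.2
      · exact absurd hv h.1
    refine GentleWins.gentleMove _ (τ v) (if s v then k else k.rev)
      (by rw [Function.update_of_ne (hne v), hτv]) ?_
    have hlt : Nat.card {u // Function.update (Function.update p v (some k)) (τ v)
        (some (if s v then k else k.rev)) u = none} < N := by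
      rw [← hN]
      refine Set.ncard_lt_ncard (s := {u | _}) (t := {u | p u = none})
        ⟨fun u hu => ?_, fun hsub => ?_⟩ (Set.toFinite _)
      · by_contra hpu
        have h1 : u ≠ v := fun h => hpu (h ▸ hv)
        have h2 : u ≠ τ v := fun h => hpu (h ▸ hτv)
        simp only [Set.mem_ofPred_eq, Function.update_of_ne h2, Function.update_of_ne h1] at hu
        exact hpu hu
      · have := hsub (a := τ v) hτv
        simp at this
    refine ih _ hlt _ rfl fun u => ?_
    have hrev : ∀ k : Fin 2, k.rev ≠ k := by decide
    have hvτ : v ≠ τ v := (hne v).symm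
    by_cases h1 : u = v
    · subst h1
      right
      by_cases hsu : s u <;> simp [Function.update_of_ne hvτ, hsu, (hrev k).symm]
    by_cases h2 : u = τ v
    · subst h2
      right
      by_cases hsu : s v <;> simp [hτ, hs, Function.update_of_ne hvτ, hsu, hrev k]
    have h3 : τ u ≠ v := fun h => h2 (by rw [← h, hτ])
    have h4 : τ u ≠ τ v := fun h => h1 (by rw [← hτ u, h, hτ])
    simpa [Function.update_of_ne, h1, h2, h3, h4] using hp u
  · push Not at hex
    choose c hc using fun v => Option.ne_none_iff_exists'.1 (hex v)
    obtain rfl : p = fun v => some (c v) := funext hc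
    refine GentleWins.finished _ c (hwin c fun u => ?_)
    simpa using hp u

/-- Gentle can win only if some distinguishing colouring exists. -/
theorem GentleWins.exists_isDistinguishing {U : Type*} {G : SimpleGraph U} {d : ℕ} {P : Player}
    {p : U → Option (Fin d)} (h : GentleWins G d P p) (hd : 0 < d) :
    ∃ c : U → Fin d, IsDistinguishing G c := by
  induction h with
  | finished _ c hc => exact ⟨c, hc⟩
  | gentleMove _ _ _ _ _ ih => exact ih
  | rascalMove _ hp _ ih =>
    obtain ⟨v, hv⟩ := hp
    exact ih v ⟨0, hd⟩ hv

/-- A nontrivial automorphism preserves the constant colouring, so one colour does not suffice. -/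
theorem gameDistNumberR_eq_two {U : Type*} {G : SimpleGraph U}
    (hG : GentleWins G 2 Player.rascal (fun _ => none)) (σ : G ≃g G) (u : U) (hσ : σ u ≠ u) :
    gameDistNumberR G = 2 := by
  refine le_antisymm (iInf₂_le 2 ⟨by norm_num, hG⟩) (le_iInf₂ fun d hd => ?_)
  suffices 2 ≤ d by exact_mod_cast this
  by_contra hlt
  obtain rfl : d = 1 := by omega
  obtain ⟨c, hc⟩ := hd.2.exists_isDistinguishing one_pos
  exact hσ (hc σ (fun v => Subsingleton.elim _ _) u)

/-! ### Distinguishing colourings -/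

theorem exists_isDistinguishing_of_distNumber_le {V : Type*} {F : SimpleGraph V} {d : ℕ}
    (h : distNumber F ≤ d) : ∃ c : V → Fin d, IsDistinguishing F c := by
  by_contra hne
  have : ((d + 1 : ℕ) : ℕ∞) ≤ distNumber F := by
    refine le_iInf₂ fun d' hd' => ?_
    obtain ⟨c, hc⟩ := hd'
    rw [Nat.cast_le]
    by_contra hlt
    refine hne ⟨fun v => Fin.castLE (by omega) (c v), fun σ hσ => hc σ fun v => ?_⟩
    exact Fin.castLE_injective _ (hσ v)
  have := this.trans h
  rw [Nat.cast_le] at this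
  omega

/-- A graph with at least `d` vertices that has a distinguishing colouring with `d` colours has one
that uses all the colours: an unused colour can be given to a vertex whose colour is not unique. -/
theorem exists_isDistinguishing_surjective {V : Type*} [Finite V] {F : SimpleGraph V} {d : ℕ}
    (hV : d ≤ Nat.card V) (h : ∃ c : V → Fin d, IsDistinguishing F c) :
    ∃ c : V → Fin d, IsDistinguishing F c ∧ Function.Surjective c := by
  classical
  obtain ⟨c, hc, hmax⟩ := Set.exists_max_image {c : V → Fin d | IsDistinguishing F c}
    (fun c => (Set.range c).ncard) (Set.toFinite _) h
  refine ⟨c, hc, ?_⟩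
  by_contra hsurj
  obtain ⟨m, hm⟩ : ∃ m, m ∉ Set.range c := by
    simpa [Function.Surjective] using hsurj
  have hinj : ¬ Function.Injective c := fun hinj => by
    have hb : Function.Bijective c := (Nat.bijective_iff_injective_and_card c).2
      ⟨hinj, le_antisymm (Nat.card_le_card_of_injective c hinj) (by simpa using hV)⟩
    exact hsurj hb.2
  obtain ⟨u, v, huv, hne⟩ : ∃ u v, c u = c v ∧ u ≠ v := by
    simpa [Function.Injective] using hinj
  have hcm (w : V) : c w ≠ m := fun hw => hm ⟨w, hw⟩
  have hc' : IsDistinguishing F (Function.update c u m) := by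
    intro σ hσ
    have hu : σ u = u := by
      by_contra hσu
      have := hσ u
      rw [Function.update_of_ne hσu, Function.update_self] at this
      exact hcm _ this
    refine hc σ fun w => ?_
    by_cases hw : w = u
    · rw [hw, hu]
    · have hσw : σ w ≠ u := fun h => hw (σ.injective (h.trans hu.symm))
      have := hσ w
      rwa [Function.update_of_ne hσw, Function.update_of_ne hw] at this
  have hsub : Set.range c ⊂ Set.range (Function.update c u m) := by
    refine ⟨?_, fun hsub => hm (hsub ⟨u, Function.update_self ..⟩)⟩
    rintro _ ⟨w, rfl⟩
    by_cases hw : w = u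
    · exact ⟨v, by rw [Function.update_of_ne hne.symm, hw, huv]⟩
    · exact ⟨w, Function.update_of_ne hw _ _⟩
  exact absurd (hmax _ hc') (not_le.2 (Set.ncard_lt_ncard hsub (Set.toFinite _)))

/-! ### The game on products with a 4-cycle or a 6-cycle -/

/-- The copy of `K` over a vertex `v` of `F` is coloured so that `w` and `τ w` have equal colours
exactly if `s (f v) w` holds. The number of such `w` is preserved by automorphisms and determines
the colour `f v`, so that the `F`-component of a colour-preserving automorphism is trivial. Two of
the patterns together admit no nontrivial automorphism of `K`. -/
theorem gameDistNumberR_boxProd_eq_two {W V : Type*} [Fintype W] [Finite V] {K : SimpleGraph W}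
    {F : SimpleGraph V} (hprod : ∀ φ : (K □ F) ≃g (K □ F),
      ∃ (a : K ≃g K) (b : F ≃g F), φ = a.boxProdCongr b)
    {d : ℕ} {f : V → Fin d} (hf : IsDistinguishing F f) {v₁ v₂ : V}
    (τ : W → W) (hτ : ∀ w, τ (τ w) = w) (hne : ∀ w, τ w ≠ w)
    (hcomm : ∀ (a : K ≃g K) w, a (τ w) = τ (a w))
    (s : Fin d → W → Bool) (hs : ∀ t w, s t (τ w) = s t w)
    (hcount : Function.Injective fun t => Fintype.card {w // s t w = true})
    (hrigid : ∀ (a : K ≃g K) (c₁ c₂ : W → Fin 2),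
      (∀ w, c₁ w = c₁ (τ w) ↔ s (f v₁) w = true) → (∀ w, c₂ w = c₂ (τ w) ↔ s (f v₂) w = true) →
      (∀ w, c₁ (a w) = c₁ w) → (∀ w, c₂ (a w) = c₂ w) → ∀ w, a w = w)
    (σ : K ≃g K) (w₀ : W) (hσ : σ w₀ ≠ w₀) :
    gameDistNumberR (K □ F) = 2 := by
  refine gameDistNumberR_eq_two (GentleWins.of_pairing _ (fun x => (τ x.1, x.2))
    (fun x => s (f x.2) x.1 = true) (fun x => by simp [hτ])
    (fun x h => hne x.1 (congrArg Prod.fst h)) (fun x => by simp [hs]) fun c hc => ?_)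
    (σ.boxProdCongr Iso.refl) (w₀, v₁) (fun h => hσ (congrArg Prod.fst h))
  intro φ hφ
  obtain ⟨a, b, rfl⟩ := hprod φ
  have hφ' (w v) : c (a w, b v) = c (w, v) := hφ (w, v)
  have hc' (w v) : c (w, v) = c (τ w, v) ↔ s (f v) w = true := hc (w, v)
  have hb : ∀ v, b v = v := by
    refine hf b fun v => hcount ?_
    refine (Fintype.card_congr (a.toEquiv.subtypeEquiv fun w => ?_)).symm
    change _ ↔ s (f (b v)) (a w) = true
    rw [← hc' w v, ← hc', ← hcomm, hφ', hφ']
  have ha : ∀ w, a w = w := by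
    refine hrigid a (fun w => c (w, v₁)) (fun w => c (w, v₂)) (fun w => hc' w v₁)
      (fun w => hc' w v₂) (fun w => ?_) (fun w => ?_)
    · have := hφ' w v₁
      rwa [hb] at this
    · have := hφ' w v₂
      rwa [hb] at this
  exact fun x => Prod.ext (ha x.1) (hb x.2)

/-- The rotation of a cycle by one step. -/
def rotation (n : ℕ) : cycleGraph (n + 2) ≃g cycleGraph (n + 2) where
  toEquiv := Equiv.addRight 1
  map_rel_iff' := by simp [cycleGraph_adj]

theorem gameDistNumberR_cycleGraph_four_boxProd {V : Type u} [Finite V] {F : SimpleGraph V}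
    (hF : F.Connected) (hV : 3 ≤ Nat.card V) (h : RelativelyPrime F (cycleGraph 4))
    (hD : distNumber F ≤ 3) : gameDistNumberR (cycleGraph 4 □ F) = 2 := by
  obtain ⟨f, hf, hsurj⟩ := exists_isDistinguishing_surjective hV
    (exists_isDistinguishing_of_distNumber_le hD)
  obtain ⟨v₁, hv₁⟩ := hsurj 1
  obtain ⟨v₂, hv₂⟩ := hsurj 2
  have anti : ∀ x y : Fin 4, y = x + 2 ↔ x ≠ y ∧ ¬ (cycleGraph 4).Adj x y := by decide
  have hcomm (a : cycleGraph 4 ≃g cycleGraph 4) (w) : a (w + 2) = a w + 2 := by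
    rw [anti, a.injective.ne_iff, a.map_adj_iff, ← anti]
  -- The three patterns have zero, one and two unequal antipodal pairs.
  refine gameDistNumberR_boxProd_eq_two (Iso.exists_eq_boxProdCongr cycleGraph_connected hF
    (snd_eq_of_relativelyPrime_cycleGraph_four hF h)) hf (v₁ := v₁) (v₂ := v₂) (· + 2)
    (by decide) (by decide) hcomm
    ![fun _ => true, fun w => w = 1 ∨ w = 3, fun _ => false] (by decide) (by decide) ?_
    (rotation 2) 0 (by decide)
  intro a c₁ c₂ hc₁ hc₂ ha₁ ha₂
  rw [hv₁] at hc₁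
  rw [hv₂] at hc₂
  -- The pattern of `c₁` distinguishes `0` and `2` from the other vertices, and these have distinct
  -- colours.
  have key₁ (x : Fin 4) : x = 0 ∨ x = 2 ↔ c₁ x ≠ c₁ (x + 2) := by
    rw [Ne, hc₁]; revert x; decide
  have h0 : a 0 = 0 := by
    have h := (key₁ (a 0)).2 (by rw [← hcomm, ha₁, ha₁, ← key₁]; decide)
    refine h.resolve_right fun h2 => (key₁ 0).1 (by decide) ?_
    rw [← ha₁ 0, h2]; rfl
  have h2 : a 2 = 2 := (hcomm a 0).trans (by rw [h0]; rfl)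
  have h1 : a 1 = 1 := by
    have hx : ∀ x : Fin 4, x ≠ 0 → x ≠ 2 → x = 1 ∨ x = 3 := by decide
    have h := hx (a 1) (fun h => absurd (a.injective (h.trans h0.symm)) (by decide))
      (fun h => absurd (a.injective (h.trans h2.symm)) (by decide))
    refine h.resolve_right fun h3 => ?_
    have := (hc₂ 1).not.2 (by decide)
    exact this (by rw [← ha₂ 1, h3]; rfl)
  have h3 : a 3 = 3 := (hcomm a 1).trans (by rw [h1]; rfl)
  intro w
  fin_cases w <;> assumption

theorem gameDistNumberR_cycleGraph_six_boxProd {V : Type u} [Finite V] {F : SimpleGraph V}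
    (hF : F.Connected) (hV : 3 ≤ Nat.card V) (h : RelativelyPrime F (cycleGraph 6))
    (hD : distNumber F ≤ 3) : gameDistNumberR (cycleGraph 6 □ F) = 2 := by
  obtain ⟨f, hf, hsurj⟩ := exists_isDistinguishing_surjective hV
    (exists_isDistinguishing_of_distNumber_le hD)
  obtain ⟨v₁, hv₁⟩ := hsurj 1
  obtain ⟨v₂, hv₂⟩ := hsurj 2
  have anti : ∀ x y : Fin 6, y = x + 3 ↔ x ≠ y ∧ ¬ (cycleGraph 6).Adj x y ∧
      ∀ z, (cycleGraph 6).Adj x z → ¬ (cycleGraph 6).Adj y z := by decide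
  have hcomm (a : cycleGraph 6 ≃g cycleGraph 6) (w) : a (w + 3) = a w + 3 := by
    rw [anti, a.injective.ne_iff, a.map_adj_iff, a.surjective.forall]
    simp only [a.map_adj_iff]
    rw [← anti]
  -- The three patterns have zero, one and two unequal antipodal pairs.
  refine gameDistNumberR_boxProd_eq_two (Iso.exists_eq_boxProdCongr cycleGraph_connected hF
    (snd_eq_of_relativelyPrime_cycleGraph_six hF h)) hf (v₁ := v₁) (v₂ := v₂) (· + 3)
    (by decide) (by decide) hcomm
    ![fun _ => true, fun w => ¬ (w = 0 ∨ w = 3), fun w => w = 1 ∨ w = 4] (by decide) (by decide)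
    ?_ (rotation 4) 0 (by decide)
  intro a c₁ c₂ hc₁ hc₂ ha₁ ha₂
  rw [hv₁] at hc₁
  rw [hv₂] at hc₂
  -- The pattern of `c₁` distinguishes `0` and `3` from the other vertices, and these have distinct
  -- colours. The pattern of `c₂` distinguishes `1` and `4` from the other vertices.
  have key₁ (x : Fin 6) : x = 0 ∨ x = 3 ↔ c₁ x ≠ c₁ (x + 3) := by
    rw [Ne, hc₁]; revert x; decide
  have key₂ (x : Fin 6) : x = 1 ∨ x = 4 ↔ c₂ x = c₂ (x + 3) := by
    rw [hc₂]; revert x; decide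
  have h0 : a 0 = 0 := by
    have h := (key₁ (a 0)).2 (by rw [← hcomm, ha₁, ha₁, ← key₁]; decide)
    refine h.resolve_right fun h3 => (key₁ 0).1 (by decide) ?_
    rw [← ha₁ 0, h3]; rfl
  have h3 : a 3 = 3 := (hcomm a 0).trans (by rw [h0]; rfl)
  have hadj0 {x : Fin 6} (hx : (cycleGraph 6).Adj 0 x) : (cycleGraph 6).Adj 0 (a x) := by
    rw [← a.map_adj_iff, h0] at hx
    exact hx
  have h1 : a 1 = 1 := by
    have h := (key₂ (a 1)).2 (by rw [← hcomm, ha₂, ha₂, ← key₂]; decide)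
    refine h.resolve_right fun h4 => ?_
    have := hadj0 (x := 1) (by decide)
    rw [h4] at this
    revert this
    decide
  have h4 : a 4 = 4 := (hcomm a 1).trans (by rw [h1]; rfl)
  have h5 : a 5 = 5 := by
    have hx : ∀ x : Fin 6, (cycleGraph 6).Adj 0 x → x ≠ 1 → x = 5 := by decide
    exact hx _ (hadj0 (by decide)) (fun h => absurd (a.injective (h.trans h1.symm)) (by decide))
  have h2 : a 2 = 2 := (hcomm a 5).trans (by rw [h5]; rfl)
  intro w
  fin_cases w <;> assumption

/-! ### Factors and distinguishing number of cycles -/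

theorem card_eq_two_of_degree_eq_one {Y : Type*} [Fintype Y] {M : SimpleGraph Y}
    [DecidableRel M.Adj] (hM : M.Connected) (h : ∀ y, M.degree y = 1) : Nat.card Y = 2 := by
  classical
  obtain ⟨y₀⟩ := hM.nonempty
  have huniq (y) : ∃! z, M.Adj y z := by
    simpa using degree_eq_one_iff_existsUnique_adj.1 (h y)
  obtain ⟨z₀, hz₀, -⟩ := huniq y₀
  have hall : ∀ y, (y = y₀ ∨ y = z₀) = (y₀ = y₀ ∨ y₀ = z₀) := fun y =>
    hM.eq_of_forall_adj (f := fun y => (y = y₀ ∨ y = z₀)) (fun x y hxy => propext ⟨?_, ?_⟩) _ _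
  · have hU : (Set.univ : Set Y) = {y₀, z₀} := by
      ext y
      simpa using hall y
    rw [← Set.ncard_univ, hU, Set.ncard_pair hz₀.ne]
  · rintro (rfl | rfl)
    · exact Or.inr ((huniq _).unique hxy hz₀)
    · exact Or.inl ((huniq _).unique hxy hz₀.symm)
  · rintro (rfl | rfl)
    · exact Or.inr ((huniq _).unique hxy.symm hz₀)
    · exact Or.inl ((huniq _).unique hxy.symm hz₀.symm)

/-- A cycle of length other than 4 is prime: if a cycle is a product of nontrivial factors, these
are connected and their degrees add up to 2, so that both factors are `K₂`. -/
theorem card_eq_of_cycleGraph_iso_boxProd {W X : Type*} {K : SimpleGraph W} {L : SimpleGraph X}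
    {m : ℕ} (hm : 3 ≤ m) (e : cycleGraph m ≃g (K □ L)) :
    Nat.card W = 1 ∨ Nat.card X = 1 ∨ Nat.card W = 2 ∧ Nat.card X = 2 := by
  classical
  obtain ⟨n, rfl⟩ : ∃ n, m = n + 3 := ⟨m - 3, by omega⟩
  have hc : (K □ L).Connected := e.connected_iff.1 cycleGraph_connected
  have hK : K.Connected := hc.ofBoxProdLeft
  have hL : L.Connected := hc.ofBoxProdRight
  have hWne := hK.nonempty
  have hXne := hL.nonempty
  have hfin : Finite (W × X) := Finite.of_equiv _ e.toEquiv
  have hW : Finite W := Finite.prod_left X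
  have hX : Finite X := Finite.prod_right W
  have := Fintype.ofFinite W
  have := Fintype.ofFinite X
  have hdeg (w : W) (x : X) : K.degree w + L.degree x = 2 := by
    rw [← degree_boxProd (w, x), ← e.symm.degree_eq, cycleGraph_degree_three_le]
  by_cases hW1 : Nat.card W = 1
  · exact Or.inl hW1
  by_cases hX1 : Nat.card X = 1
  · exact Or.inr (Or.inl hX1)
  have hWn : Nontrivial W := Finite.one_lt_card_iff_nontrivial.1
    (by have := Nat.card_pos (α := W); omega)
  have hXn : Nontrivial X := Finite.one_lt_card_iff_nontrivial.1
    (by have := Nat.card_pos (α := X); omega)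
  have hKp (w) : 0 < K.degree w := hK.preconnected.degree_pos_of_nontrivial w
  have hLp (x) : 0 < L.degree x := hL.preconnected.degree_pos_of_nontrivial x
  refine Or.inr (Or.inr ⟨?_, ?_⟩)
  · obtain ⟨x⟩ := hXne
    exact card_eq_two_of_degree_eq_one hK fun w => by have := hdeg w x; have := hKp w; have := hLp x; omega
  · obtain ⟨w⟩ := hWne
    exact card_eq_two_of_degree_eq_one hL fun x => by have := hdeg w x; have := hKp w; have := hLp x; omega

theorem card_eq_of_isCartesianFactor_cycleGraph {k m : ℕ} {K : SimpleGraph (Fin k)} (hk : 2 ≤ k)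
    (hm : 3 ≤ m) (h : IsCartesianFactor K (cycleGraph m)) : k = m ∨ k = 2 ∧ m = 4 := by
  obtain ⟨X, L, ⟨e⟩⟩ := h
  have hcard : m = k * Nat.card X := by
    simpa using Nat.card_congr e.toEquiv
  rcases card_eq_of_cycleGraph_iso_boxProd hm e with h | h | ⟨h, h'⟩
  · simp at h; omega
  · rw [h] at hcard; omega
  · simp at h; rw [h, h'] at hcard; omega

theorem relativelyPrime_cycleGraph {m n : ℕ} (hm : 3 ≤ m) (hn : 3 ≤ n) (hne : m ≠ n) :
    RelativelyPrime (cycleGraph m) (cycleGraph n) := by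
  intro k K hk h h'
  have h1 := card_eq_of_isCartesianFactor_cycleGraph hk hm h
  have h2 := card_eq_of_isCartesianFactor_cycleGraph hk hn h'
  omega

open Fin.NatCast Fin.CommRing in
/-- Colour `0` and `1` uniquely and all other vertices alike: an automorphism of a cycle that fixes
two adjacent vertices is trivial. -/
theorem distNumber_cycleGraph_le {m : ℕ} (hm : 3 ≤ m) : distNumber (cycleGraph m) ≤ 3 := by
  obtain ⟨n, rfl⟩ : ∃ n, m = n + 3 := ⟨m - 3, by omega⟩
  refine iInf₂_le 3 ⟨fun v => if v = 0 then 0 else if v = 1 then 1 else 2, fun σ hσ => ?_⟩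
  have h0 : σ 0 = 0 := by
    have := hσ 0
    by_contra h
    by_cases h1 : σ 0 = 1 <;> simp [h, h1] at this
  have h1 : σ 1 = 1 := by
    have := hσ 1
    by_contra h
    by_cases h1 : σ 1 = 0 <;> simp [h, h1] at this
  have key (i : ℕ) : σ (i : Fin (n + 3)) = i ∧
      σ ((i + 1 : ℕ) : Fin (n + 3)) = ((i + 1 : ℕ) : Fin (n + 3)) := by
    induction i with
    | zero => simpa using ⟨h0, h1⟩
    | succ i ih =>
      refine ⟨ih.2, ?_⟩
      have hadj : (cycleGraph (n + 3)).Adj ((i + 1 : ℕ) : Fin (n + 3))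
          ((i + 1 + 1 : ℕ) : Fin (n + 3)) := by
        rw [cycleGraph_adj]
        right
        push_cast
        ring
      rw [← σ.map_adj_iff, ih.2, cycleGraph_adj] at hadj
      rcases hadj with h | h
      · -- The other neighbour of `i + 1` is `i`, the image of `i ≠ i + 2`.
        exfalso
        have h2 : σ ((i + 1 + 1 : ℕ) : Fin (n + 3)) = σ (i : Fin (n + 3)) := by
          rw [ih.1]
          have := sub_eq_iff_eq_add.1 h
          push_cast at this ⊢
          rw [add_comm 1] at this
          exact (add_right_cancel this).symm
        have h3 := σ.injective h2
        push_cast at h3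
        rw [add_assoc, add_eq_left] at h3
        have h4 : ((2 : ℕ) : Fin (n + 3)) = 0 := by
          rw [← h3]; norm_num
        rw [Fin.natCast_eq_zero] at h4
        exact absurd (Nat.le_of_dvd two_pos h4) (by omega)
      · rw [sub_eq_iff_eq_add.1 h]
        push_cast
        ring
  intro v
  simpa using (key v).1

end DistinguishingGame

theorem proposition5p2 :
    (∀ n : ℕ, n = 4 ∨ n = 6 → ∀ (V : Type u) [Finite V] (F : SimpleGraph V),
      F.Connected → 3 ≤ Nat.card V →
      DistinguishingGame.RelativelyPrime F (SimpleGraph.cycleGraph n) →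
      DistinguishingGame.distNumber F ≤ 3 →
      DistinguishingGame.gameDistNumberR (SimpleGraph.cycleGraph n □ F) = 2) ∧
    (∀ m : ℕ, 3 ≤ m → m ≠ 6 →
      DistinguishingGame.gameDistNumberR
        (SimpleGraph.cycleGraph 6 □ SimpleGraph.cycleGraph m) = 2) ∧
    (∀ m : ℕ, 3 ≤ m → m ≠ 4 →
      DistinguishingGame.gameDistNumberR
        (SimpleGraph.cycleGraph 4 □ SimpleGraph.cycleGraph m) = 2) := by
  have hcycle (m : ℕ) (hm : 3 ≤ m) : (SimpleGraph.cycleGraph m).Connected := by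
    obtain ⟨n, rfl⟩ : ∃ n, m = n + 1 := ⟨m - 1, by omega⟩
    exact SimpleGraph.cycleGraph_connected
  refine ⟨?_, fun m hm hne => ?_, fun m hm hne => ?_⟩
  · rintro n (rfl | rfl) V _ F hF hV h hD
    · exact DistinguishingGame.gameDistNumberR_cycleGraph_four_boxProd hF hV h hD
    · exact DistinguishingGame.gameDistNumberR_cycleGraph_six_boxProd hF hV h hD
  · exact DistinguishingGame.gameDistNumberR_cycleGraph_six_boxProd (hcycle m hm)
      (by simpa using hm)
      (DistinguishingGame.relativelyPrime_cycleGraph hm (by norm_num) hne)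
      (DistinguishingGame.distNumber_cycleGraph_le hm)
  · exact DistinguishingGame.gameDistNumberR_cycleGraph_four_boxProd (hcycle m hm)
      (by simpa using hm)
      (DistinguishingGame.relativelyPrime_cycleGraph hm (by norm_num) hne)
      (DistinguishingGame.distNumber_cycleGraph_le hm)
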